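/- Let $l\ge 3$ and consider the cycle with vertices $0,\dots,l-1$ and edges $e_i=\{i,i+1\}$ (indices modulo $l$). Let $\mathcal X$ be the set of families $x=(x^i_k)_{k\ge 0,\,0\le i<l}$ of positive reals with $\sum_k x^i_k<\infty$ for all $i$. For $x\in\mathcal X$ and a starting vertex $v_0$, the time-line walk driven by $x$ is defined as follows: the time-line of $e_i$ is a half-line carrying dots at the points $x^i_0+\dots+x^i_n$, $n\ge 0$; when the walk is at a vertex $v$, the not yet erased parts of the time-lines of the two incident edges $e_{v-1}$ and $e_v$ are erased simultaneously at rate $1$ until the next dot is met on one of them, and the walk then crosses the corresponding edge (the one of smaller index if two dots are met at once); and so on. Let $s^i$ be the total time spent at vertex $i$, $y=(s^0,\dots,s^{l-1})$ the vector of vertex occupation times, $z=(s^i+s^{i+1})_{0\le i<l}$, and let $M^{(l)}$ be the $l\times l$ circulant matrix whose $i$-th row is the indicator function of $\{i,i+1\}$. (a) $\det M^{(l)}=1-(-1)^l$; hence $M^{(l)}$ is invertible if and only if $l$ is odd. For every $x\in\mathcal X$ and every $v_0$, the times $s^i$ are finite and $z=M^{(l)}y$. Now let $W:\{0,1,\dots\}\to(0,\infty)$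 satisfy $\sum_k 1/W(k)<\infty$, let $X_0^{e_i}\in\{0,1,\dots\}$ be initial edge weights, and let the walk be driven by a family $E=(E^i_k)_{k\ge0,\,0\le i<l}$ of independent random variables, $E^i_k$ being exponential with mean $1/W(X_0^{e_i}+k)$; almost surely $E\in\mathcal X$. Fix $v_0$ and let $A_{all}$ be the event that the walk started at $v_0$ visits every vertex at least once. Then: (b) for all $\beta'\in\mathbb R^l\setminus\{0\}$ and $c\in\mathbb R$, $\mathbb P(A_{all}\cap\{\beta'\cdot y=c\})=0$; (c) if $l$ is odd, then for all $\beta\in\mathbb R^l\setminus\{0\}$ and $c\in\mathbb R$, $\mathbb P(A_{all}\cap\{\beta\cdot z=c\})=0$; (d) for every $(l-1)$-dimensional differentiable submanifold $M\subset\mathbb R^l$ (every $p\in M$ has an open neighbourhood $U\subset\mathbb R^l$ with a bijection $h$ from $U$ onto an open set $V\subset\mathbb R^l$, $h$ and $h^{-1}$ differentiable, such that $h(U\cap M)=\{v\in V: v_l=0\}$), $\mathbb P(A_{all}\cap\{y\in M\})=0$; (e) for every open $A\subset\mathbb R^l$ and every differentiable $F:A\to\mathbb R$ whose gradient does not vanish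 at any zero of $F$ in $A$, $\mathbb P(A_{all}\cap\{y\in A,\ F(y)=0\})=0$. -/

import Mathlib

open MeasureTheory ProbabilityTheory
open scoped Matrix

namespace TimeLine

/-- The set of admissible families of gaps `x i k` (`i` a time-line, `k` a dot): all gaps are
positive and every time-line has finite total length. -/
def Admissible (l : ℕ) : Set (Fin l → ℕ → ℝ) :=
  {x | ∀ i, (∀ k, 0 < x i k) ∧ Summable (x i)}

/-- The state of the time-line construction on the cycle with vertices `Fin l` and edges
`e_i = {i, i + 1}` (addition modulo `l`): the current position, the number of times each edge has
been traversed (the number of dots used up on its time-line), and the length of the initial segment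
of each time-line that has been erased. -/
structure State (l : ℕ) where
  pos : Fin l
  cnt : Fin l → ℕ
  erased : Fin l → ℝ

/-- The length of what is left on the time-line of `e_i` before its next dot. The dots on this
time-line are at `x i 0`, `x i 0 + x i 1`, `x i 0 + x i 1 + x i 2`, ... -/
noncomputable def residual {l : ℕ} (x : Fin l → ℕ → ℝ) (s : State l) (i : Fin l) : ℝ :=
  (∑ m ∈ Finset.range (s.cnt i + 1), x i m) - s.erased i

/-- The time the walk waits at its current position: the two time-lines of the incident edges
`e_v` and `e_{v-1}` are erased at rate one until the first dot is met. -/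
noncomputable def wait {l : ℕ} [NeZero l] (x : Fin l → ℕ → ℝ) (s : State l) : ℝ :=
  min (residual x s (s.pos - 1)) (residual x s s.pos)

/-- The edge, among `e_{v-1}` and `e_v`, on whose time-line the next dot is met; if dots are met on
both time-lines simultaneously, the edge of smaller index is taken. -/
noncomputable def nextEdge {l : ℕ} [NeZero l] (x : Fin l → ℕ → ℝ) (s : State l) : Fin l :=
  if residual x s s.pos < residual x s (s.pos - 1) then s.pos
  else if residual x s (s.pos - 1) < residual x s s.pos then s.pos - 1
  else min (s.pos - 1) s.pos

/-- One step: erase the two time-lines of the incident edges up to the next dot, and traverse the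
corresponding edge. -/
noncomputable def step {l : ℕ} [NeZero l] (x : Fin l → ℕ → ℝ) (s : State l) : State l where
  pos := if nextEdge x s = s.pos then s.pos + 1 else s.pos - 1
  cnt := fun i => if i = nextEdge x s then s.cnt i + 1 else s.cnt i
  erased := fun i => if i = s.pos - 1 ∨ i = s.pos then s.erased i + wait x s else s.erased i

/-- The state after `n` jumps of the deterministic walk driven by `x` and started at `v₀`. -/
noncomputable def state {l : ℕ} [NeZero l] (x : Fin l → ℕ → ℝ) (v₀ : Fin l) (n : ℕ) : State l :=
  (step x)^[n] { pos := v₀, cnt := fun _ => 0, erased := fun _ => 0 }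

/-- The time spent at vertex `i` between the `n`-th and the `(n + 1)`-st jump. -/
noncomputable def sojourn {l : ℕ} [NeZero l] (x : Fin l → ℕ → ℝ) (v₀ i : Fin l) (n : ℕ) : ℝ :=
  if (state x v₀ n).pos = i then wait x (state x v₀ n) else 0

/-- The vector `y` of vertex occupation times: coordinate `i` is the total time spent at `i`. -/
noncomputable def vertexTime {l : ℕ} [NeZero l] (x : Fin l → ℕ → ℝ) (v₀ : Fin l) : Fin l → ℝ :=
  fun i => ∑' n, sojourn x v₀ i n

/-- The vector `z`: coordinate `i` is the total time spent at the endpoints `i`, `i + 1` of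
`e_i`. -/
noncomputable def edgeTime {l : ℕ} [NeZero l] (x : Fin l → ℕ → ℝ) (v₀ : Fin l) : Fin l → ℝ :=
  fun i => vertexTime x v₀ i + vertexTime x v₀ (i + 1)

/-- The walk driven by `x` visits every vertex at least once. -/
def VisitsAll {l : ℕ} [NeZero l] (x : Fin l → ℕ → ℝ) (v₀ : Fin l) : Prop :=
  ∀ i, ∃ n, (state x v₀ n).pos = i

/-- The circulant matrix whose `i`-th row is the characteristic function of `{i, i + 1}`. -/
def cycleMatrix (l : ℕ) [NeZero l] : Matrix (Fin l) (Fin l) ℝ :=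
  Matrix.of fun i j => if j = i ∨ j = i + 1 then 1 else 0

/-- `M` is an `(l - 1)`-dimensional differentiable submanifold of `ℝ^l`: around each of its points
there is a diffeomorphism `h` between open subsets `U`, `V` of `ℝ^l` with
`h (U ∩ M) = {v ∈ V | the last coordinate of v is 0}`. Only differentiability of `h` and of its
inverse is required, so that `C^1` and smooth hypersurfaces are covered. -/
def IsDifferentiableHypersurface {l : ℕ} [NeZero l] (M : Set (Fin l → ℝ)) : Prop :=
  ∀ p ∈ M, ∃ h : OpenPartialHomeomorph (Fin l → ℝ) (Fin l → ℝ),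
    p ∈ h.source ∧ DifferentiableOn ℝ h h.source ∧ DifferentiableOn ℝ h.symm h.target ∧
    h '' (h.source ∩ M) =
      {v | v ∈ h.target ∧ v ⟨l - 1, Nat.sub_lt (NeZero.pos l) Nat.one_pos⟩ = 0}

end TimeLine

/-!
Why the occupation times charge no hypersurface. Let `v` be a vertex and consider one sojourn of
the walk at `v`, of length `w > 0`. During it one gap of each of the time-lines of `e_{v-1}` and
`e_v` is being erased. If both gaps are shortened by the same `ε < w`, the walk follows the same
trajectory and all its sojourns keep their lengths, except this one, which becomes `w - ε`
(`wait_shorten`). Doing this at every vertex shows that, as soon as all vertices are visited, the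
vector `y` of occupation times can be lowered by any small vector `ε ≥ 0` through a translation of
finitely many gaps (`vertexTime_sub_slack`).

By the memoryless property, translating finitely many coordinates of a product of exponential
distributions upwards yields a multiple of its restriction to a set of the form `{x | a ≤ x}`
(`infinitePi_expMeasure_map_add`); hence such translations, in both directions, preserve null sets
of positive gaps. This gives two facts. First, almost surely no two dots are met at the same time,
so that all sojourns have positive length (`ae_residual_pos`). Second, if `N` is Lebesgue-null,
then by Fubini `y + ε ∉ N` almost surely, for almost every `ε`; choosing such `ε > 0` arbitrarily
small and undoing the translation of the gaps gives `y ∉ N` almost surely on the event that all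
vertices are visited (`measure_vertexTime_mem_eq_zero`).

So the law of `y` on this event is absolutely continuous, and it remains to see that hyperplanes,
differentiable hypersurfaces and regular zero sets of differentiable functions are Lebesgue-null.
A hypersurface is locally the image of part of a hyperplane under a differentiable map. For a
function which is only differentiable the implicit function theorem is not available; instead, at
a Lebesgue density point of its zero set the gradient has to vanish (`volume_zero_set_eq_zero`).
-/

/-! ### The deterministic walk -/

namespace TimeLine

section Deterministic

variable {l : ℕ} [NeZero l] {x x' : Fin l → ℕ → ℝ} {v₀ : Fin l}

theorem nextEdge_mem (x : Fin l → ℕ → ℝ) (s : State l) :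
    nextEdge x s = s.pos - 1 ∨ nextEdge x s = s.pos := by
  unfold nextEdge
  split_ifs
  · exact Or.inr rfl
  · exact Or.inl rfl
  · exact min_choice _ _

theorem residual_nextEdge (x : Fin l → ℕ → ℝ) (s : State l) :
    residual x s (nextEdge x s) = wait x s := by
  unfold nextEdge wait
  split_ifs with h₁ h₂
  · exact (min_eq_right h₁.le).symm
  · exact (min_eq_left h₂.le).symm
  · have h : residual x s s.pos = residual x s (s.pos - 1) := by linarith
    rcases min_choice (s.pos - 1) s.pos with h' | h' <;> rw [h', h, min_self]

theorem wait_le_residual (x : Fin l → ℕ → ℝ) (s : State l) {i : Fin l}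
    (hi : i = s.pos - 1 ∨ i = s.pos) : wait x s ≤ residual x s i := by
  rcases hi with rfl | rfl
  · exact min_le_left _ _
  · exact min_le_right _ _

/-- The choice of the next edge is robust: it survives a change of the residual lengths which keeps
that of the edge crossed next, and which either does not decrease that of the other edge or leaves
it strictly larger. -/
theorem nextEdge_congr {s s' : State l} (hpos : s'.pos = s.pos)
    (hf : residual x' s' (nextEdge x s) = residual x s (nextEdge x s))
    (hg : ∀ g, (g = s.pos - 1 ∨ g = s.pos) → g ≠ nextEdge x s →
      wait x s < residual x' s' g ∨ residual x s g ≤ residual x' s' g) :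
    nextEdge x' s' = nextEdge x s ∧ wait x' s' = wait x s := by
  rw [residual_nextEdge] at hf
  have key : nextEdge x' s' = nextEdge x s := by
    have h₁ := hg (s.pos - 1) (Or.inl rfl)
    have h₂ := hg s.pos (Or.inr rfl)
    have h₃ := wait_le_residual x s (Or.inl rfl : s.pos - 1 = s.pos - 1 ∨ _)
    have h₄ := wait_le_residual x s (Or.inr rfl : s.pos = s.pos - 1 ∨ _)
    have h₅ := residual_nextEdge x s
    by_cases hne : s.pos - 1 = s.pos
    · rcases nextEdge_mem x s with h | h <;> rcases nextEdge_mem x' s' with h' | h' <;>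
        rw [h, h', hpos] <;> simp [hne]
    rcases nextEdge_mem x s with h | h
    · rw [h] at hf h₅ h₂ ⊢
      have h₂ := h₂ (Ne.symm hne)
      unfold nextEdge at h ⊢
      rw [hpos]
      split_ifs at h with c₁ c₂
      · exact absurd h.symm hne
      · have : residual x' s' (s.pos - 1) < residual x' s' s.pos := by
          rcases h₂ with h₂ | h₂ <;> linarith
        rw [if_neg this.not_gt, if_pos this]
      · have : residual x' s' (s.pos - 1) ≤ residual x' s' s.pos := by
          rcases h₂ with h₂ | h₂ <;> linarith
        rw [if_neg this.not_gt]
        split_ifs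
        · rfl
        · exact h
    · rw [h] at hf h₅ h₁ ⊢
      have h₁ := h₁ hne
      unfold nextEdge at h ⊢
      rw [hpos]
      split_ifs at h with c₁ c₂
      · have : residual x' s' s.pos < residual x' s' (s.pos - 1) := by
          rcases h₁ with h₁ | h₁ <;> linarith
        rw [if_pos this]
      · exact absurd h hne
      · have : residual x' s' s.pos ≤ residual x' s' (s.pos - 1) := by
          rcases h₁ with h₁ | h₁ <;> linarith
        rw [if_neg this.not_gt]
        split_ifs
        · rfl
        · exact h
  exact ⟨key, by rw [← residual_nextEdge x' s', key, hf]⟩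

theorem state_succ (x : Fin l → ℕ → ℝ) (v₀ : Fin l) (n : ℕ) :
    state x v₀ (n + 1) = step x (state x v₀ n) :=
  Function.iterate_succ_apply' _ _ _

theorem residual_step_nextEdge (x : Fin l → ℕ → ℝ) (s : State l) :
    residual x (step x s) (nextEdge x s) = x (nextEdge x s) (s.cnt (nextEdge x s) + 1) := by
  have h := residual_nextEdge x s
  unfold residual at h ⊢
  have h' := nextEdge_mem x s
  simp only [step, if_true, if_pos h']
  rw [Finset.sum_range_succ]
  linarith

theorem residual_step_of_ne (x : Fin l → ℕ → ℝ) (s : State l) {i : Fin l}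
    (hi : i ≠ nextEdge x s) :
    residual x (step x s) i =
      residual x s i - if i = s.pos - 1 ∨ i = s.pos then wait x s else 0 := by
  unfold residual
  simp only [step, if_neg hi]
  split_ifs <;> ring

theorem residual_nonneg (hx : ∀ i k, 0 < x i k) (n : ℕ) (i : Fin l) :
    0 ≤ residual x (state x v₀ n) i := by
  induction n generalizing i with
  | zero => simpa [residual, state] using (hx i 0).le
  | succ n ih =>
    rw [state_succ]
    by_cases hi : i = nextEdge x (state x v₀ n)
    · rw [hi, residual_step_nextEdge]
      exact (hx _ _).le
    · rw [residual_step_of_ne x _ hi]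
      split_ifs with h
      · linarith [wait_le_residual x _ h]
      · linarith [ih i]

theorem wait_nonneg (hx : ∀ i k, 0 < x i k) (n : ℕ) : 0 ≤ wait x (state x v₀ n) :=
  le_min (residual_nonneg hx n _) (residual_nonneg hx n _)

theorem residual_le_gap (hx : ∀ i k, 0 < x i k) (n : ℕ) (i : Fin l) :
    residual x (state x v₀ n) i ≤ x i ((state x v₀ n).cnt i) := by
  induction n generalizing i with
  | zero => simp [residual, state]
  | succ n ih =>
    rw [state_succ]
    by_cases hi : i = nextEdge x (state x v₀ n)
    · rw [hi, residual_step_nextEdge]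
      simp [step]
    · rw [residual_step_of_ne x _ hi]
      have h₁ := ih i
      have h₂ := wait_nonneg (v₀ := v₀) hx n
      simp only [step, if_neg hi]
      split_ifs <;> linarith

theorem cnt_mono (x : Fin l → ℕ → ℝ) (v₀ i : Fin l) :
    Monotone fun n => (state x v₀ n).cnt i := by
  refine monotone_nat_of_le_succ fun n => ?_
  rw [state_succ]
  simp only [step]
  split_ifs <;> omega

theorem erased_mono (hx : ∀ i k, 0 < x i k) (i : Fin l) :
    Monotone fun n => (state x v₀ n).erased i := by
  refine monotone_nat_of_le_succ fun n => ?_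
  rw [state_succ]
  have h₂ := wait_nonneg (v₀ := v₀) hx n
  simp only [step]
  split_ifs <;> linarith

theorem residual_anti (hx : ∀ i k, 0 < x i k) {m n : ℕ} (hmn : m ≤ n) {i : Fin l}
    (h : (state x v₀ m).cnt i = (state x v₀ n).cnt i) :
    residual x (state x v₀ n) i ≤ residual x (state x v₀ m) i := by
  unfold residual
  rw [h]
  have := erased_mono (v₀ := v₀) hx i hmn
  simp only at this
  linarith

theorem sum_sojourn_le_erased (hx : ∀ i k, 0 < x i k) (i : Fin l) (n : ℕ) :
    ∑ m ∈ Finset.range n, sojourn x v₀ i m ≤ (state x v₀ n).erased i := by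
  induction n with
  | zero => simp [state]
  | succ n ih =>
    rw [Finset.sum_range_succ, state_succ]
    have h₂ := wait_nonneg (v₀ := v₀) hx n
    unfold sojourn at ih ⊢
    simp only [step]
    split_ifs with c₁ c₂ c₂
    · linarith
    · exact absurd (Or.inr c₁.symm) c₂
    · linarith
    · linarith

/-- The time spent at `i` is erased from the time-line of `e_i`, whose total length is finite. -/
theorem summable_sojourn (hx : x ∈ Admissible l) (v₀ i : Fin l) :
    Summable (sojourn x v₀ i) := by
  have hpos : ∀ i k, 0 < x i k := fun i => (hx i).1
  refine summable_of_sum_range_le (c := ∑' k, x i k) (fun n => ?_) fun n => ?_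
  · unfold sojourn
    split_ifs
    · exact wait_nonneg hpos n
    · exact le_rfl
  · have h₁ := residual_nonneg (v₀ := v₀) hpos n i
    have h₂ := (hx i).2.sum_le_tsum (Finset.range ((state x v₀ n).cnt i + 1))
      fun k _ => (hpos i k).le
    have h₃ := sum_sojourn_le_erased (v₀ := v₀) hpos i n
    unfold residual at h₁
    linarith

/-- The family of gaps obtained from `x` by shortening by `ε` the gaps that are being erased in the
state `s`. -/
noncomputable def shorten (x : Fin l → ℕ → ℝ) (s : State l) (ε : ℝ) : Fin l → ℕ → ℝ :=
  fun i k => x i k - if (i = s.pos - 1 ∨ i = s.pos) ∧ k = s.cnt i then ε else 0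

theorem sum_range_shorten (x : Fin l → ℕ → ℝ) (s : State l) (ε : ℝ) (i : Fin l) (n : ℕ) :
    ∑ k ∈ Finset.range (n + 1), shorten x s ε i k =
      (∑ k ∈ Finset.range (n + 1), x i k) -
        if (i = s.pos - 1 ∨ i = s.pos) ∧ s.cnt i ≤ n then ε else 0 := by
  simp only [shorten, Finset.sum_sub_distrib]
  by_cases h : i = s.pos - 1 ∨ i = s.pos
  · simp [h, Finset.sum_ite_eq']
  · simp [h]

/-- If the shortened walk is in the expected state at time `n`, then it makes the same next jump as
the original walk, and it waits equally long except at time `n₀`. -/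
theorem nextEdge_wait_shorten (hx : ∀ i k, 0 < x i k) {n₀ : ℕ} {ε : ℝ}
    (hw : ε < wait x (state x v₀ n₀)) {n : ℕ} {s' : State l}
    (hpos : s'.pos = (state x v₀ n).pos) (hcnt : s'.cnt = (state x v₀ n).cnt)
    (her : ∀ i, s'.erased i = (state x v₀ n).erased i -
      if (i = (state x v₀ n₀).pos - 1 ∨ i = (state x v₀ n₀).pos) ∧ n₀ < n then ε else 0) :
    nextEdge (shorten x (state x v₀ n₀) ε) s' = nextEdge x (state x v₀ n) ∧
    wait (shorten x (state x v₀ n₀) ε) s' =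
      wait x (state x v₀ n) - if n = n₀ then ε else 0 := by
  set s₀ := state x v₀ n₀ with hs₀
  set s := state x v₀ n with hs
  -- the residual length is lower by `ε` from when the shortened gap is reached up to time `n₀`
  have hres : ∀ i, residual (shorten x s₀ ε) s' i = residual x s i -
      if (i = s₀.pos - 1 ∨ i = s₀.pos) ∧ n ≤ n₀ ∧ s.cnt i = s₀.cnt i then ε else 0 := by
    intro i
    unfold residual
    rw [her, hcnt, sum_range_shorten]
    by_cases hi : i = s₀.pos - 1 ∨ i = s₀.pos
    · rcases le_or_gt n n₀ with hn | hn
      · have hm : s.cnt i ≤ s₀.cnt i := cnt_mono x v₀ i hn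
        have : s₀.cnt i ≤ s.cnt i ↔ s.cnt i = s₀.cnt i := by omega
        simp only [hi, hn, hn.not_gt, this, true_and, and_false, if_false]
        ring
      · have hm : s₀.cnt i ≤ s.cnt i := cnt_mono x v₀ i hn.le
        simp only [hi, hn, hn.not_ge, hm, true_and, and_true, false_and, if_false, if_true]
        ring
    · simp [hi]
  rcases lt_trichotomy n n₀ with hn | hn | hn
  · rw [if_neg hn.ne, sub_zero]
    refine nextEdge_congr hpos ?_ ?_
    · -- the edge crossed at time `n` has moved on to another gap by time `n₀`
      rw [hres, if_neg, sub_zero]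
      rintro ⟨-, -, h⟩
      have h' := cnt_mono x v₀ (nextEdge x s) (Nat.succ_le_of_lt hn)
      simp only [Nat.succ_eq_add_one, state_succ, ← hs, ← hs₀] at h'
      simp only [step, if_true] at h'
      omega
    · intro g hg hne
      rw [hres]
      split_ifs with h
      · -- what is left of the gap of `g` after this sojourn still outlasts the one at time `n₀`
        left
        obtain ⟨hg₀, -, hc⟩ := h
        have h₁ : residual x s₀ g ≤ residual x (state x v₀ (n + 1)) g := by
          refine residual_anti hx hn ?_
          rw [state_succ, ← hs, ← hs₀]
          simp only [step, if_neg hne]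
          exact hc
        rw [state_succ, ← hs, residual_step_of_ne x s hne, if_pos hg] at h₁
        have h₂ := wait_le_residual x s₀ hg₀
        linarith
      · right; simp
  · subst hn
    have h₁ : residual (shorten x s₀ ε) s' (s.pos - 1) = residual x s (s.pos - 1) - ε := by
      rw [hres, if_pos ⟨Or.inl rfl, le_rfl, rfl⟩]
    have h₂ : residual (shorten x s₀ ε) s' s.pos = residual x s s.pos - ε := by
      rw [hres, if_pos ⟨Or.inr rfl, le_rfl, rfl⟩]
    constructor
    · unfold nextEdge
      rw [hpos, h₁, h₂]
      simp only [sub_lt_sub_iff_right]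
    · unfold wait
      rw [hpos, h₁, h₂, if_pos rfl, min_sub_sub_right]
  · rw [if_neg hn.ne', sub_zero]
    refine nextEdge_congr hpos ?_ fun g _ _ => Or.inr ?_
    · rw [hres, if_neg, sub_zero]
      rintro ⟨-, h, -⟩
      omega
    · rw [hres, if_neg, sub_zero]
      rintro ⟨-, h, -⟩
      omega

theorem state_shorten (hx : ∀ i k, 0 < x i k) {n₀ : ℕ} {ε : ℝ}
    (hw : ε < wait x (state x v₀ n₀)) (n : ℕ) :
    (state (shorten x (state x v₀ n₀) ε) v₀ n).pos = (state x v₀ n).pos ∧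
    (state (shorten x (state x v₀ n₀) ε) v₀ n).cnt = (state x v₀ n).cnt ∧
    ∀ i, (state (shorten x (state x v₀ n₀) ε) v₀ n).erased i = (state x v₀ n).erased i -
      if (i = (state x v₀ n₀).pos - 1 ∨ i = (state x v₀ n₀).pos) ∧ n₀ < n then ε else 0 := by
  induction n with
  | zero => simp [state]
  | succ n ih =>
    obtain ⟨hpos, hcnt, her⟩ := ih
    obtain ⟨hf, hw'⟩ := nextEdge_wait_shorten hx hw hpos hcnt her
    rw [state_succ, state_succ]
    simp only [step, hf, hw', hpos, hcnt, her, true_and]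
    intro i
    rcases lt_trichotomy n n₀ with hn | rfl | hn
    · have h₁ : ¬ n₀ < n := by omega
      have h₂ : ¬ n₀ < n + 1 := by omega
      simp [h₁, h₂, hn.ne]
    · simp only [lt_irrefl, and_false, if_false, sub_zero, if_true, Nat.lt_succ_self, and_true]
      split_ifs <;> ring
    · have h₂ : n₀ < n + 1 := by omega
      simp only [hn, h₂, hn.ne', and_true, if_false]
      split_ifs <;> ring

/-- Shortening by `ε` the two gaps being erased during a sojourn at `v` longer than `ε` changes
neither the trajectory nor the other sojourns; it lowers the time spent at `v` by `ε`. -/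
theorem wait_shorten (hx : ∀ i k, 0 < x i k) {n₀ : ℕ} {ε : ℝ}
    (hw : ε < wait x (state x v₀ n₀)) (n : ℕ) :
    wait (shorten x (state x v₀ n₀) ε) (state (shorten x (state x v₀ n₀) ε) v₀ n) =
      wait x (state x v₀ n) - if n = n₀ then ε else 0 := by
  obtain ⟨hpos, hcnt, her⟩ := state_shorten hx hw n
  exact (nextEdge_wait_shorten hx hw hpos hcnt her).2

theorem admissible_shorten (hx : x ∈ Admissible l) {n₀ : ℕ} {ε : ℝ}
    (hw : ε < wait x (state x v₀ n₀)) :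
    shorten x (state x v₀ n₀) ε ∈ Admissible l := by
  have hpos : ∀ i k, 0 < x i k := fun i => (hx i).1
  intro i
  constructor
  · intro k
    unfold shorten
    split_ifs with h
    · obtain ⟨hi, rfl⟩ := h
      have h₁ := residual_le_gap (v₀ := v₀) hpos n₀ i
      have h₂ := wait_le_residual x _ hi
      linarith
    · simpa using hpos i k
  · refine (hx i).2.sub (summable_of_hasFiniteSupport
      ((Set.finite_singleton ((state x v₀ n₀).cnt i)).subset ?_))
    intro k hk
    by_contra hne
    exact hk (if_neg fun h => hne h.2)

theorem vertexTime_shorten (hx : x ∈ Admissible l) {n₀ : ℕ} {ε : ℝ}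
    (hw : ε < wait x (state x v₀ n₀)) :
    vertexTime (shorten x (state x v₀ n₀) ε) v₀ =
      vertexTime x v₀ - Pi.single (state x v₀ n₀).pos ε := by
  have hpos : ∀ i k, 0 < x i k := fun i => (hx i).1
  funext i
  have h : ∀ n, sojourn (shorten x (state x v₀ n₀) ε) v₀ i n = sojourn x v₀ i n -
      if n = n₀ then (if (state x v₀ n₀).pos = i then ε else 0) else 0 := by
    intro n
    unfold sojourn
    rw [(state_shorten hpos hw n).1, wait_shorten hpos hw]
    by_cases hn : n = n₀
    · subst hn
      split_ifs <;> simp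
    · simp [hn]
  have h' : HasSum (fun n => if n = n₀ then (if (state x v₀ n₀).pos = i then ε else 0) else 0)
      (if (state x v₀ n₀).pos = i then ε else 0) := hasSum_ite_eq n₀ _
  unfold vertexTime
  simp only [h, Pi.sub_apply]
  rw [(summable_sojourn hx v₀ i).tsum_sub h'.summable, h'.tsum_eq, Pi.single_apply]
  simp only [eq_comm]

/-- The effect on the gaps of removing time `ε i` from a sojourn at each vertex `i` which takes
place while `κ i (i - 1)` and `κ i i` dots are used up on the time-lines of `e_{i-1}` and `e_i`. -/
noncomputable def slack (κ : Fin l → Fin l → ℕ) (ε : Fin l → ℝ) (p : Fin l × ℕ) : ℝ :=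
  ∑ i, if (p.1 = i - 1 ∨ p.1 = i) ∧ p.2 = κ i p.1 then ε i else 0

/-- Simultaneous version of `vertexTime_shorten`: the occupation times of all vertices can be
lowered independently by small amounts, by a translation of the gaps. -/
theorem vertexTime_sub_slack (hx : x ∈ Admissible l) {n : Fin l → ℕ}
    (hn : ∀ i, (state x v₀ (n i)).pos = i) {ε : Fin l → ℝ}
    (hw : ∀ i, ε i < wait x (state x v₀ (n i))) :
    (fun i k => x i k - slack (fun j => (state x v₀ (n j)).cnt) ε (i, k)) ∈ Admissible l ∧
    vertexTime (fun i k => x i k - slack (fun j => (state x v₀ (n j)).cnt) ε (i, k)) v₀ =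
      vertexTime x v₀ - ε := by
  have main : ∀ S : Finset (Fin l), ∃ x' : Fin l → ℕ → ℝ,
      (x' = fun i k => x i k - ∑ j ∈ S,
        if (i = j - 1 ∨ i = j) ∧ k = (state x v₀ (n j)).cnt i then ε j else 0) ∧
      x' ∈ Admissible l ∧
      (∀ m, (state x' v₀ m).pos = (state x v₀ m).pos ∧ (state x' v₀ m).cnt = (state x v₀ m).cnt) ∧
      (∀ j ∉ S, wait x' (state x' v₀ (n j)) = wait x (state x v₀ (n j))) ∧
      vertexTime x' v₀ = vertexTime x v₀ - ∑ j ∈ S, Pi.single j (ε j) := by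
    intro S
    induction S using Finset.induction_on with
    | empty => exact ⟨x, by simp, hx, fun _ => ⟨rfl, rfl⟩, fun _ _ => rfl, by simp⟩
    | insert j S hj ih =>
      obtain ⟨y, hy, hya, hys, hyw, hyt⟩ := ih
      have hlt : ε j < wait y (state y v₀ (n j)) := by rw [hyw j hj]; exact hw j
      have hyp : ∀ i k, 0 < y i k := fun i => (hya i).1
      have hpj : (state y v₀ (n j)).pos = j := (hys _).1.trans (hn j)
      refine ⟨shorten y (state y v₀ (n j)) (ε j), ?_, admissible_shorten hya hlt, ?_, ?_, ?_⟩
      · funext i k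
        rw [shorten, hpj, (hys _).2, Finset.sum_insert hj, hy]
        ring
      · intro m
        have h := state_shorten hyp hlt m
        exact ⟨h.1.trans (hys m).1, h.2.1.trans (hys m).2⟩
      · intro i hi
        rw [Finset.mem_insert, not_or] at hi
        -- the chosen sojourns are distinct, since they take place at distinct vertices
        have hne : n i ≠ n j := fun h => hi.1 (by rw [← hn i, ← hn j, h])
        rw [wait_shorten hyp hlt, if_neg hne, sub_zero, hyw i hi.2]
      · rw [vertexTime_shorten hya hlt, hyt, Finset.sum_insert hj, hpj]
        abel
  obtain ⟨x', hx', ha, -, -, ht⟩ := main Finset.univ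
  have h : x' = fun i k => x i k - slack (fun j => (state x v₀ (n j)).cnt) ε (i, k) := hx'
  rw [← h]
  exact ⟨ha, by rw [ht, Finset.univ_sum_single]⟩

/-- Lengthening a gap which is not used up by time `n` does not affect the walk before time `n`. -/
theorem state_lengthen {j : Fin l} {k n : ℕ} (hk : (state x v₀ n).cnt j = k) {δ : ℝ}
    (hδ : 0 ≤ δ) {m : ℕ} (hm : m ≤ n) :
    state (fun i r => x i r + if i = j ∧ r = k then δ else 0) v₀ m = state x v₀ m := by
  set x' : Fin l → ℕ → ℝ := fun i r => x i r + if i = j ∧ r = k then δ else 0 with hx'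
  induction m with
  | zero => rfl
  | succ m ih =>
    rw [state_succ, state_succ, ih (by omega)]
    have hle : (state x v₀ (m + 1)).cnt j ≤ k := hk ▸ cnt_mono x v₀ j hm
    rw [state_succ] at hle
    set s := state x v₀ m
    obtain ⟨h₁, h₂⟩ : nextEdge x' s = nextEdge x s ∧ wait x' s = wait x s := by
      refine nextEdge_congr rfl ?_ fun g _ _ => Or.inr ?_
      · unfold residual
        congr 1
        refine Finset.sum_congr rfl fun r hr => ?_
        rw [hx']
        simp only [add_eq_left, ite_eq_right_iff]
        rintro ⟨rfl, rfl⟩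
        simp only [step, if_true] at hle
        rw [Finset.mem_range] at hr
        omega
      · unfold residual
        gcongr with r
        rw [hx']
        simp only [le_add_iff_nonneg_right]
        split_ifs
        · exact hδ
        · exact le_rfl
    simp only [step, h₁, h₂]

theorem residual_lengthen {j : Fin l} {k n : ℕ} (hk : (state x v₀ n).cnt j = k) {δ : ℝ}
    (hδ : 0 ≤ δ) :
    residual (fun i r => x i r + if i = j ∧ r = k then δ else 0)
      (state (fun i r => x i r + if i = j ∧ r = k then δ else 0) v₀ n) j =
      residual x (state x v₀ n) j + δ := by
  rw [state_lengthen hk hδ le_rfl]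
  unfold residual
  rw [hk]
  simp only [true_and, Finset.sum_add_distrib, Finset.sum_ite_eq', Finset.mem_range,
    Nat.lt_succ_self, if_true]
  ring

end Deterministic

end TimeLine

/-! ### Independent exponential gaps -/

namespace TimeLine

open scoped ENNReal

theorem expMeasure_eq_withDensity (r : ℝ) :
    expMeasure r = volume.withDensity (exponentialPDF r) := rfl

theorem measurable_exponentialPDF (r : ℝ) : Measurable (exponentialPDF r) :=
  (measurable_exponentialPDFReal r).ennreal_ofReal

/-- The memoryless property of the exponential distribution, as an identity of measures. -/
theorem map_add_expMeasure (r : ℝ) {a : ℝ} (ha : 0 ≤ a) :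
    (expMeasure r).map (· + a) =
      ENNReal.ofReal (Real.exp (r * a)) • (expMeasure r).restrict (Set.Ici a) := by
  ext B hB
  have hm : Measurable fun x : ℝ => x + a := measurable_add_const a
  rw [Measure.map_apply hm hB, Measure.smul_apply, Measure.restrict_apply hB, smul_eq_mul,
    expMeasure_eq_withDensity, withDensity_apply _ (hm hB),
    withDensity_apply _ (hB.inter measurableSet_Ici),
    ← lintegral_const_mul _ (measurable_exponentialPDF r),
    ← lintegral_indicator (hm hB), ← lintegral_indicator (hB.inter measurableSet_Ici),
    ← lintegral_add_right_eq_self (μ := volume)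
      ((B ∩ Set.Ici a).indicator _) a]
  refine lintegral_congr fun x => ?_
  by_cases hx : x + a ∈ B
  · rcases le_or_gt 0 x with h0 | h0
    · rw [Set.indicator_of_mem (s := (fun x => x + a) ⁻¹' B) hx,
        Set.indicator_of_mem (show x + a ∈ B ∩ Set.Ici a from ⟨hx, by simpa using h0⟩),
        exponentialPDF_of_nonneg h0, exponentialPDF_of_nonneg (add_nonneg h0 ha),
        ← ENNReal.ofReal_mul (Real.exp_pos _).le, mul_left_comm, ← Real.exp_add]
      congr 3
      ring_nf
    · rw [Set.indicator_of_mem (s := (fun x => x + a) ⁻¹' B) hx, exponentialPDF_of_neg h0,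
        Set.indicator_of_notMem]
      rintro ⟨-, h⟩
      simp only [Set.mem_Ici] at h
      linarith
  · rw [Set.indicator_of_notMem (s := (fun x => x + a) ⁻¹' B) hx,
      Set.indicator_of_notMem (fun h => hx h.1)]

theorem ae_expMeasure_pos (r : ℝ) : ∀ᵐ x ∂expMeasure r, 0 < x := by
  rw [expMeasure_eq_withDensity, ae_withDensity_iff (measurable_exponentialPDF r)]
  have h : ∀ᵐ x : ℝ, x ≠ 0 := by simp [ae_iff]
  filter_upwards [h] with x hx hpdf
  by_contra hneg
  exact hpdf (exponentialPDF_of_neg (lt_of_le_of_ne (not_lt.1 hneg) hx))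

theorem lintegral_expMeasure {r : ℝ} (hr : 0 < r) :
    ∫⁻ x, ENNReal.ofReal x ∂expMeasure r = ENNReal.ofReal (1 / r) := by
  rw [expMeasure_eq_withDensity, lintegral_withDensity_eq_lintegral_mul _
    (measurable_exponentialPDF r) ENNReal.measurable_ofReal]
  -- up to the factor `1 / r`, the integrand is the density of the Gamma distribution of shape `2`
  have h : ∀ x, (exponentialPDF r * fun x => ENNReal.ofReal x) x =
      ENNReal.ofReal (1 / r) * gammaPDF 2 r x := by
    intro x
    rw [Pi.mul_apply]
    rcases le_or_gt 0 x with h0 | h0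
    · rw [exponentialPDF_of_nonneg h0, gammaPDF_of_nonneg h0,
        ← ENNReal.ofReal_mul (by positivity), ← ENNReal.ofReal_mul (by positivity)]
      congr 1
      norm_num
      field_simp
    · rw [exponentialPDF_of_neg h0, gammaPDF_of_neg h0, zero_mul, mul_zero]
  rw [lintegral_congr h, lintegral_const_mul' _ _ ENNReal.ofReal_ne_top,
    lintegral_gammaPDF_eq_one two_pos hr, mul_one]

/-- If finitely many factors of a product measure turn under a translation into multiples of their
restrictions, then so does the product. -/
theorem infinitePi_map_add {ι : Type*} (μ : ι → Measure ℝ) [∀ i, IsProbabilityMeasure (μ i)]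
    (a : ι → ℝ) (s : Finset ι) (hs : ∀ i ∉ s, a i = 0) (c : ι → ℝ≥0∞) (D : ι → Set ℝ)
    (hD : ∀ i, MeasurableSet (D i))
    (h : ∀ i ∈ s, (μ i).map (· + a i) = c i • (μ i).restrict (D i)) :
    (Measure.infinitePi μ).map (· + a) =
      (∏ i ∈ s, c i) • (Measure.infinitePi μ).restrict ((s : Set ι).pi D) := by
  classical
  have hm : ∀ i, IsProbabilityMeasure ((μ i).map (· + a i)) := fun i =>
    Measure.isProbabilityMeasure_map (measurable_add_const _).aemeasurable
  have h₁ : (Measure.infinitePi μ).map (· + a) =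
      Measure.infinitePi fun i => (μ i).map (· + a i) :=
    Measure.infinitePi_map_pi μ (f := fun i x => x + a i) fun i => measurable_add_const _
  rw [h₁]
  symm
  refine Measure.eq_infinitePi _ fun t B hB => ?_
  have hbox : (t : Set ι).pi B ∩ (s : Set ι).pi D = ((t ∪ s : Finset ι) : Set ι).pi fun i =>
      (if i ∈ t then B i else Set.univ) ∩ (if i ∈ s then D i else Set.univ) := by
    ext x
    simp only [Set.mem_inter_iff, Set.mem_pi, Finset.coe_union, Set.mem_union, Finset.mem_coe]
    constructor
    · rintro ⟨h₁, h₂⟩ i -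
      constructor
      · split_ifs with hi
        exacts [h₁ i hi, trivial]
      · split_ifs with hi
        exacts [h₂ i hi, trivial]
    · intro h
      refine ⟨fun i hi => ?_, fun i hi => ?_⟩
      · have := (h i (Or.inl hi)).1
        rwa [if_pos hi] at this
      · have := (h i (Or.inr hi)).2
        rwa [if_pos hi] at this
  have hBm : ∀ i, MeasurableSet (if i ∈ t then B i else Set.univ) := fun i => by
    split_ifs
    exacts [hB i, .univ]
  have hDm : ∀ i, MeasurableSet (if i ∈ s then D i else Set.univ) := fun i => by
    split_ifs
    exacts [hD i, .univ]
  have hc : ∏ i ∈ s, c i = ∏ i ∈ t ∪ s, if i ∈ s then c i else 1 :=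
    Finset.prod_subset_one_on_sdiff Finset.subset_union_right
      (fun i hi => if_neg (Finset.mem_sdiff.1 hi).2) fun i hi => (if_pos hi).symm
  have hR : ∏ i ∈ t, (μ i).map (· + a i) (B i) =
      ∏ i ∈ t ∪ s, (μ i).map (· + a i) (if i ∈ t then B i else Set.univ) :=
    Finset.prod_subset_one_on_sdiff Finset.subset_union_left
      (fun i hi => by rw [if_neg (Finset.mem_sdiff.1 hi).2, measure_univ])
      fun i hi => by rw [if_pos hi]
  rw [Measure.smul_apply, Measure.restrict_apply (.pi t.countable_toSet fun i _ => hB i), hbox,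
    Measure.infinitePi_pi _ (fun i _ => (hBm i).inter (hDm i)), smul_eq_mul, hc, hR,
    ← Finset.prod_mul_distrib]
  refine Finset.prod_congr rfl fun i _ => ?_
  by_cases hi : i ∈ s
  · rw [h i hi, Measure.smul_apply, Measure.restrict_apply (hBm i), if_pos hi, if_pos hi,
      smul_eq_mul]
  · simp [hi, hs i hi]

section ExpProduct

variable {ι : Type*} {r : ι → ℝ} [∀ i, IsProbabilityMeasure (expMeasure (r i))] {a : ι → ℝ}

/-- The memoryless property of a product of exponential distributions, for a translation in finitely
many coordinates. -/
theorem infinitePi_expMeasure_map_add (ha : ∀ i, 0 ≤ a i) (s : Finset ι) (hs : ∀ i ∉ s, a i = 0) :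
    (Measure.infinitePi fun i => expMeasure (r i)).map (· + a) =
      (∏ i ∈ s, ENNReal.ofReal (Real.exp (r i * a i))) •
        (Measure.infinitePi fun i => expMeasure (r i)).restrict
          ((s : Set ι).pi fun i => Set.Ici (a i)) :=
  infinitePi_map_add _ a s hs _ _ (fun _ => measurableSet_Ici)
    fun i _ => map_add_expMeasure (r i) (ha i)

theorem measure_preimage_add_eq_zero (ha : ∀ i, 0 ≤ a i) (hs : a.support.Finite)
    {Z : Set (ι → ℝ)} (hZ : Measure.infinitePi (fun i => expMeasure (r i)) Z = 0) :
    Measure.infinitePi (fun i => expMeasure (r i)) {z | z + a ∈ Z} = 0 := by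
  have h : (Measure.infinitePi fun i => expMeasure (r i)).map (· + a) Z = 0 := by
    rw [infinitePi_expMeasure_map_add ha hs.toFinset fun i hi => by simpa using hi,
      Measure.smul_apply, smul_eq_mul, mul_eq_zero]
    exact Or.inr (Measure.restrict_le_self.absolutelyContinuous hZ)
  exact Measure.preimage_null_of_map_null (measurable_add_const a).aemeasurable h

theorem measure_preimage_sub_eq_zero (ha : ∀ i, 0 ≤ a i) (hs : a.support.Finite)
    {Z : Set (ι → ℝ)} (hZ : Measure.infinitePi (fun i => expMeasure (r i)) Z = 0)
    (hpos : ∀ z ∈ Z, ∀ i, 0 ≤ z i) :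
    Measure.infinitePi (fun i => expMeasure (r i)) {z | z - a ∈ Z} = 0 := by
  have hm : (Measure.infinitePi fun i => expMeasure (r i)).map (· + a) {z | z - a ∈ Z} = 0 := by
    rw [show (fun z : ι → ℝ => z + a) = MeasurableEquiv.addRight a from rfl,
      MeasurableEquiv.map_apply]
    simpa using hZ
  rw [infinitePi_expMeasure_map_add ha hs.toFinset fun i hi => by simpa using hi,
    Measure.smul_apply, Measure.restrict_eq_self, smul_eq_mul, mul_eq_zero,
    Finset.prod_eq_zero_iff] at hm
  · rcases hm with ⟨i, -, hi⟩ | hm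
    · exact absurd hi (ENNReal.ofReal_pos.2 (Real.exp_pos _)).ne'
    · exact hm
  · -- translates of nonnegative points lie in the set to which the product measure is restricted
    intro z hz i _
    have := hpos _ hz i
    simpa using this

end ExpProduct

section Gaps

variable {l : ℕ} {r : Fin l × ℕ → ℝ} [∀ p, IsProbabilityMeasure (expMeasure (r p))]

theorem ae_admissible (hr : ∀ p, 0 < r p) (hsum : ∀ i, Summable fun k => 1 / r (i, k)) :
    ∀ᵐ z ∂Measure.infinitePi (fun p => expMeasure (r p)), (fun i k => z (i, k)) ∈ Admissible l := by
  have hpos : ∀ᵐ z ∂Measure.infinitePi (fun p => expMeasure (r p)), ∀ p, 0 < z p :=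
    ae_all_iff.2 fun p =>
      (measurePreserving_eval_infinitePi (fun p => expMeasure (r p)) p).quasiMeasurePreserving.ae
        (ae_expMeasure_pos (r p))
  have hfin : ∀ᵐ z ∂Measure.infinitePi (fun p => expMeasure (r p)), ∀ i,
      ∑' k, ENNReal.ofReal (z (i, k)) < ∞ := by
    refine ae_all_iff.2 fun i => ae_lt_top (by fun_prop) ?_
    have hm : ∀ k, Measurable fun z : Fin l × ℕ → ℝ => ENNReal.ofReal (z (i, k)) := fun k => by
      fun_prop
    rw [lintegral_tsum fun k => (hm k).aemeasurable]
    have h : ∀ k, ∫⁻ z, ENNReal.ofReal (z (i, k)) ∂Measure.infinitePi (fun p => expMeasure (r p)) =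
        ENNReal.ofReal (1 / r (i, k)) := fun k => by
      rw [← lintegral_expMeasure (hr (i, k))]
      exact (measurePreserving_eval_infinitePi (fun p => expMeasure (r p)) (i, k)).lintegral_comp
        ENNReal.measurable_ofReal
    simp only [h]
    exact (hsum i).tsum_ofReal_ne_top
  filter_upwards [hpos, hfin] with z h₁ h₂ i
  refine ⟨fun k => h₁ (i, k), ?_⟩
  refine (ENNReal.summable_toReal (h₂ i).ne).congr fun k => ?_
  exact ENNReal.toReal_ofReal (h₁ (i, k)).le

end Gaps

end TimeLine

/-! ### The circulant matrix -/

namespace TimeLine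

theorem cycleMatrix_mulVec {l : ℕ} [NeZero l] (hl : 2 ≤ l) (y : Fin l → ℝ) (i : Fin l) :
    (cycleMatrix l *ᵥ y) i = y i + y (i + 1) := by
  have hne : i ≠ i + 1 := by
    simpa using (show l ≠ 1 by omega)
  simp only [cycleMatrix, Matrix.mulVec, dotProduct, Matrix.of_apply, ite_mul, one_mul, zero_mul]
  rw [← Finset.sum_filter, show (Finset.univ.filter fun j => j = i ∨ j = i + 1) = {i, i + 1} by
    ext j; simp, Finset.sum_pair hne]

/-- In the Leibniz formula only the identity and the cyclic rotation contribute. -/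
theorem det_cycleMatrix {l : ℕ} [NeZero l] (hl : 2 ≤ l) :
    (cycleMatrix l).det = 1 - (-1 : ℝ) ^ l := by
  obtain ⟨m, rfl⟩ : ∃ m, l = m + 2 := ⟨l - 2, by omega⟩
  rw [← Matrix.det_transpose, Matrix.det_apply']
  have hone : ∀ i : Fin (m + 2), i ≠ i + 1 := fun i => by simp
  have hrot : finRotate (m + 2) ≠ 1 := fun h => by
    have := Equiv.congr_fun h 0
    rw [finRotate_apply] at this
    exact hone 0 this.symm
  rw [← Finset.sum_subset (Finset.subset_univ {1, finRotate (m + 2)}),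
    Finset.sum_pair hrot.symm]
  · simp [cycleMatrix, sign_finRotate]
    ring
  · intro σ _ hσ
    simp only [Finset.mem_insert, Finset.mem_singleton, not_or] at hσ
    obtain ⟨h₁, h₂⟩ := hσ
    rw [mul_eq_zero, Finset.prod_eq_zero_iff]
    right
    by_contra! hne
    have hmem : ∀ i, σ i = i ∨ σ i = i + 1 := fun i => by
      by_contra h
      exact hne i (Finset.mem_univ i) (by simp [cycleMatrix, Matrix.transpose, h])
    -- injectivity propagates `σ i = i + 1` around the cycle
    obtain ⟨i₀, hi₀⟩ : ∃ i, σ i = i + 1 := by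
      by_contra! h
      exact h₁ (Equiv.ext fun i => (hmem i).resolve_right (h i))
    have hprop : ∀ k, σ (i₀ + k) = i₀ + k + 1 := by
      intro k
      induction k using Fin.induction with
      | zero => simpa using hi₀
      | succ k ih =>
        rw [← Fin.coeSucc_eq_succ, ← add_assoc]
        refine (hmem _).resolve_left fun h => ?_
        exact hone _ ((σ.injective (h.trans ih.symm)).symm)
    refine h₂ (Equiv.ext fun i => ?_)
    have := hprop (i - i₀)
    rw [add_sub_cancel] at this
    rw [this, finRotate_apply]

theorem isUnit_cycleMatrix_iff {l : ℕ} [NeZero l] (hl : 2 ≤ l) :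
    IsUnit (cycleMatrix l) ↔ Odd l := by
  rw [Matrix.isUnit_iff_isUnit_det, det_cycleMatrix hl, isUnit_iff_ne_zero]
  rcases Nat.even_or_odd l with h | h
  · simp [h.neg_one_pow, h]
  · simp [h.neg_one_pow, h]

/-! ### Lebesgue-null sets -/

/-- At a density point of the zero set of `F` the derivative of `F` vanishes. -/
theorem volume_zero_set_eq_zero {ι : Type*} [Fintype ι] {A : Set (ι → ℝ)} {F : (ι → ℝ) → ℝ}
    (hA : IsOpen A) (hF : DifferentiableOn ℝ F A)
    (hgrad : ∀ u ∈ A, F u = 0 → fderiv ℝ F u ≠ 0) : volume {u | u ∈ A ∧ F u = 0} = 0 := by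
  set s : Set (ι → ℝ) := {u | u ∈ A ∧ F u = 0} with hs
  have hsm : MeasurableSet s := by
    obtain ⟨C, hC, hC'⟩ := continuousOn_iff_isClosed.1 hF.continuousOn {0} isClosed_singleton
    have : s = C ∩ A := by
      rw [← hC']
      ext u
      simp [hs, and_comm]
    rw [this]
    exact hC.measurableSet.inter hA.measurableSet
  -- a scalar function is turned into a self-map by multiplication with a constant vector
  have happ : ApproximatesLinearOn (fun u => F u • (1 : ι → ℝ)) (0 : (ι → ℝ) →L[ℝ] ι → ℝ) s 0 := by
    intro u hu v hv
    simp [hu.2, hv.2]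
  have h := happ.norm_fderiv_sub_le volume hsm
    (fun u => (fderiv ℝ F u).smulRight (1 : ι → ℝ)) fun u hu =>
      (((hF u hu.1).differentiableAt (hA.mem_nhds hu.1)).hasFDerivAt.smul_const
        (1 : ι → ℝ)).hasFDerivWithinAt
  have hfalse : ∀ᵐ u ∂volume.restrict s, False := by
    filter_upwards [h, ae_restrict_mem hsm] with u hu hus
    have h0 : (fderiv ℝ F u).smulRight (1 : ι → ℝ) = 0 := by
      rw [sub_zero, nonpos_iff_eq_zero, nnnorm_eq_zero] at hu
      exact hu
    refine hgrad u hus.1 hus.2 (ContinuousLinearMap.ext fun v => ?_)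
    rcases isEmpty_or_nonempty ι with hι | ⟨⟨i⟩⟩
    · rw [Subsingleton.elim v 0]
      simp
    · simpa using congrFun (DFunLike.congr_fun h0 v) i
  simpa using hfalse

theorem volume_hypersurface_eq_zero {l : ℕ} [NeZero l] {M : Set (Fin l → ℝ)}
    (hM : IsDifferentiableHypersurface M) : volume M = 0 := by
  refine measure_null_of_locally_null M fun p hp => ?_
  obtain ⟨h, hps, -, hd, him⟩ := hM p hp
  refine ⟨h.source ∩ M, ?_, ?_⟩
  · rw [Set.inter_comm]
    exact inter_mem_nhdsWithin _ (h.open_source.mem_nhds hps)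
  · have hsub : h.source ∩ M ⊆ h.symm '' (h '' (h.source ∩ M)) := by
      intro u hu
      exact ⟨h u, ⟨u, hu, rfl⟩, h.left_inv hu.1⟩
    refine measure_mono_null hsub ?_
    rw [him]
    refine addHaar_image_eq_zero_of_differentiableOn_of_addHaar_eq_zero volume
      (hd.mono fun v hv => hv.1) ?_
    exact measure_mono_null (fun v hv => hv.2) (Measure.pi_hyperplane (fun _ => volume) _ 0)

theorem volume_hyperplane_eq_zero {ι : Type*} [Fintype ι] {β : ι → ℝ} (hβ : β ≠ 0) (c : ℝ) :
    volume {u : ι → ℝ | β ⬝ᵥ u = c} = 0 := by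
  have hd : ∀ u : ι → ℝ, HasFDerivAt (fun u => β ⬝ᵥ u - c)
      (∑ i, β i • ContinuousLinearMap.proj (R := ℝ) (φ := fun _ : ι => ℝ) i) u := by
    intro u
    refine HasFDerivAt.sub_const c ?_
    have h := (∑ i, β i • ContinuousLinearMap.proj (R := ℝ) (φ := fun _ : ι => ℝ) i).hasFDerivAt
      (x := u)
    refine h.congr_of_eventuallyEq (Filter.Eventually.of_forall fun v => ?_)
    simp [dotProduct]
  have h := volume_zero_set_eq_zero (F := fun u : ι → ℝ => β ⬝ᵥ u - c) isOpen_univ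
    (fun u _ => (hd u).differentiableAt.differentiableWithinAt) fun u _ _ h0 => by
      rw [(hd u).fderiv] at h0
      refine hβ (funext fun i => ?_)
      classical
      simpa [Pi.single_apply] using DFunLike.congr_fun h0 (Pi.single i 1)
  simpa [sub_eq_zero] using h

end TimeLine

/-! ### Measurability of the walk -/

namespace TimeLine

section Measurability

variable {α : Type*} [MeasurableSpace α] {l : ℕ}

theorem measurable_eval_index {g : α → Fin l → ℝ} (hg : ∀ i, Measurable fun a => g a i)
    {p : α → Fin l} (hp : Measurable p) : Measurable fun a => g a (p a) := by
  have h : Measurable fun q : Fin l × α => g q.2 q.1 := measurable_from_prod_countable_right hg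
  exact h.comp (hp.prodMk measurable_id)

theorem measurable_residual {f : α → Fin l → ℕ → ℝ} (hf : ∀ i k, Measurable fun a => f a i k)
    {s : α → State l} (hc : ∀ i, Measurable fun a => (s a).cnt i)
    (he : ∀ i, Measurable fun a => (s a).erased i) (i : Fin l) :
    Measurable fun a => residual (f a) (s a) i := by
  have h : Measurable fun q : ℕ × α => ∑ m ∈ Finset.range (q.1 + 1), f q.2 i m :=
    measurable_from_prod_countable_right fun n =>
      Finset.measurable_sum (Finset.range (n + 1)) fun m _ => hf i m
  exact (h.comp ((hc i).prodMk measurable_id)).sub (he i)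

variable [NeZero l]

theorem measurable_wait_nextEdge {f : α → Fin l → ℕ → ℝ}
    (hf : ∀ i k, Measurable fun a => f a i k) {s : α → State l}
    (hp : Measurable fun a => (s a).pos) (hc : ∀ i, Measurable fun a => (s a).cnt i)
    (he : ∀ i, Measurable fun a => (s a).erased i) :
    (Measurable fun a => wait (f a) (s a)) ∧ Measurable fun a => nextEdge (f a) (s a) := by
  have hp' : Measurable fun a => (s a).pos - 1 :=
    (Measurable.of_discrete (f := fun p : Fin l => p - 1)).comp hp
  have h₁ := measurable_eval_index (measurable_residual hf hc he) hp
  have h₂ := measurable_eval_index (measurable_residual hf hc he) hp'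
  refine ⟨h₂.min h₁, ?_⟩
  unfold nextEdge
  refine Measurable.ite (measurableSet_lt h₁ h₂) hp (Measurable.ite (measurableSet_lt h₂ h₁) hp' ?_)
  exact (Measurable.of_discrete (f := fun p : Fin l => min (p - 1) p)).comp hp

theorem measurable_state {f : α → Fin l → ℕ → ℝ} (hf : ∀ i k, Measurable fun a => f a i k)
    (v₀ : Fin l) (n : ℕ) :
    (Measurable fun a => (state (f a) v₀ n).pos) ∧
    (∀ i, Measurable fun a => (state (f a) v₀ n).cnt i) ∧
    ∀ i, Measurable fun a => (state (f a) v₀ n).erased i := by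
  induction n with
  | zero => exact ⟨measurable_const, fun _ => measurable_const, fun _ => measurable_const⟩
  | succ n ih =>
    obtain ⟨hp, hc, he⟩ := ih
    obtain ⟨hw, hn⟩ := measurable_wait_nextEdge hf hp hc he
    simp only [state_succ, step]
    refine ⟨?_, fun i => ?_, fun i => ?_⟩
    · exact (Measurable.of_discrete
        (f := fun q : Fin l × Fin l => if q.1 = q.2 then q.2 + 1 else q.2 - 1)).comp (hn.prodMk hp)
    · exact (Measurable.of_discrete
        (f := fun q : Fin l × ℕ => if i = q.1 then q.2 + 1 else q.2)).comp (hn.prodMk (hc i))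
    · exact Measurable.ite (hp (MeasurableSet.of_discrete (s := {p | i = p - 1 ∨ i = p})))
        ((he i).add hw) (he i)

theorem measurable_sojourn {f : α → Fin l → ℕ → ℝ} (hf : ∀ i k, Measurable fun a => f a i k)
    (v₀ i : Fin l) (n : ℕ) : Measurable fun a => sojourn (f a) v₀ i n := by
  obtain ⟨hp, hc, he⟩ := measurable_state hf v₀ n
  exact Measurable.ite (hp (measurableSet_singleton i))
    (measurable_wait_nextEdge hf hp hc he).1 measurable_const

theorem aemeasurable_vertexTime {f : α → Fin l → ℕ → ℝ}
    (hf : ∀ i k, Measurable fun a => f a i k) {μ : Measure α}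
    (ha : ∀ᵐ a ∂μ, f a ∈ Admissible l) (v₀ : Fin l) :
    AEMeasurable (fun a => vertexTime (f a) v₀) μ := by
  refine aemeasurable_pi_lambda _ fun i => ?_
  refine aemeasurable_of_tendsto_metrizable_ae Filter.atTop
    (f := fun n a => ∑ m ∈ Finset.range n, sojourn (f a) v₀ i m)
    (fun n => (Finset.measurable_sum _ fun m _ => measurable_sojourn hf v₀ i m).aemeasurable) ?_
  filter_upwards [ha] with a h
  exact (summable_sojourn h v₀ i).hasSum.tendsto_sum_nat

end Measurability

/-! ### Absolute continuity of the occupation times -/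

section AbsolutelyContinuous

variable {l : ℕ} [NeZero l] {r : Fin l × ℕ → ℝ} [∀ p, IsProbabilityMeasure (expMeasure (r p))]

/-- Almost surely two dots are never met at the same time. Lengthening the current gap of a
time-line by `δ` increases its residual length by `δ` without affecting the past of the walk, and
for all but countably many `δ` the residual length has probability `0` of being equal to `δ`. -/
theorem ae_residual_pos (hr : ∀ p, 0 < r p) (hsum : ∀ i, Summable fun k => 1 / r (i, k))
    (v₀ : Fin l) :
    ∀ᵐ z ∂Measure.infinitePi (fun p => expMeasure (r p)), ∀ n i,
      0 < residual (fun i k => z (i, k)) (state (fun i k => z (i, k)) v₀ n) i := by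
  set ν := Measure.infinitePi (fun p => expMeasure (r p)) with hν
  have hmeas : ∀ (i : Fin l) (k : ℕ), Measurable fun z : Fin l × ℕ → ℝ => z (i, k) :=
    fun i k => measurable_pi_apply (i, k)
  refine ae_all_iff.2 fun n => ae_all_iff.2 fun j => ?_
  set R : (Fin l × ℕ → ℝ) → ℝ := fun z =>
    residual (fun i k => z (i, k)) (state (fun i k => z (i, k)) v₀ n) j with hR
  have hRm : Measurable R := by
    obtain ⟨-, hc, he⟩ := measurable_state (f := fun (z : Fin l × ℕ → ℝ) i k => z (i, k)) hmeas v₀ n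
    exact measurable_residual hmeas hc he j
  obtain ⟨δ, hδ, hδ0⟩ : ∃ δ : ℝ, 0 < δ ∧ ν {z | R z = δ} = 0 := by
    obtain ⟨δ, hδ, hδ'⟩ := ((Measure.countable_meas_level_set_pos (μ := ν) hRm).dense_compl
      ℝ).exists_mem_open isOpen_Ioi ⟨1, one_pos (α := ℝ)⟩
    exact ⟨δ, hδ', nonpos_iff_eq_zero.1 (not_lt.1 hδ)⟩
  have hnull : ∀ k, ν {z | R z = 0 ∧ (state (fun i k => z (i, k)) v₀ n).cnt j = k} = 0 := by
    intro k
    have h := measure_preimage_add_eq_zero (r := r) (a := Pi.single (j, k) δ)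
      (fun p => by
        rw [Pi.single_apply]
        split_ifs
        exacts [hδ.le, le_rfl])
      ((Set.finite_singleton (j, k)).subset Pi.support_single_subset) hδ0
    refine measure_mono_null (fun z hz => ?_) h
    obtain ⟨hz0, hzk⟩ := hz
    have h' := residual_lengthen hzk hδ.le
    have hx : (fun i k' => (z + Pi.single (j, k) δ : Fin l × ℕ → ℝ) (i, k')) =
        fun i k' => z (i, k') + if i = j ∧ k' = k then δ else 0 := by
      funext i k'
      simp [Pi.single_apply]
    change residual _ _ _ = _
    rw [hx, h', show residual _ _ _ = 0 from hz0, zero_add]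
  filter_upwards [ae_admissible hr hsum,
    ae_all_iff.2 fun k => measure_eq_zero_iff_ae_notMem.1 (hnull k)] with z hz hz'
  refine lt_of_le_of_ne (residual_nonneg (fun i => (hz i).1) n j) fun h => ?_
  exact hz' _ ⟨h.symm, rfl⟩

/-- On the event that all vertices are visited, the law of the occupation times of the vertices
is absolutely continuous with respect to Lebesgue measure. By Fubini's theorem, a Lebesgue-null
set `N` is avoided by the occupation times translated by almost every `ε`; the occupation times
can be lowered by small positive `ε` by translating the gaps, and this preserves null sets of
gaps. -/
theorem measure_vertexTime_mem_eq_zero (hr : ∀ p, 0 < r p)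
    (hsum : ∀ i, Summable fun k => 1 / r (i, k)) (v₀ : Fin l) {N : Set (Fin l → ℝ)}
    (hN : volume N = 0) :
    Measure.infinitePi (fun p => expMeasure (r p))
      {z | VisitsAll (fun i k => z (i, k)) v₀ ∧ vertexTime (fun i k => z (i, k)) v₀ ∈ N} = 0 := by
  set ν := Measure.infinitePi (fun p => expMeasure (r p)) with hν
  set Y : (Fin l × ℕ → ℝ) → Fin l → ℝ := fun z => vertexTime (fun i k => z (i, k)) v₀ with hY
  have hYm : AEMeasurable Y ν := aemeasurable_vertexTime
    (f := fun (z : Fin l × ℕ → ℝ) i k => z (i, k)) (fun i k => measurable_pi_apply (i, k))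
    (ae_admissible hr hsum) v₀
  have hfub : ∀ᵐ ε : Fin l → ℝ, ν {z | Y z + ε ∈ N} = 0 := by
    have hNm := measurableSet_toMeasurable volume N
    have h₁ : ∀ᵐ z ∂ν, ∀ᵐ ε : Fin l → ℝ, hYm.mk Y z + ε ∉ toMeasurable volume N :=
      Filter.Eventually.of_forall fun z => by
        rw [ae_iff]
        simp only [not_not]
        rw [show {ε | hYm.mk Y z + ε ∈ toMeasurable volume N} =
          (fun ε => hYm.mk Y z + ε) ⁻¹' toMeasurable volume N from rfl, measure_preimage_add,
          measure_toMeasurable, hN]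
    rw [Measure.ae_ae_comm] at h₁
    · filter_upwards [h₁] with ε hε
      rw [measure_eq_zero_iff_ae_notMem]
      filter_upwards [hε, hYm.ae_eq_mk] with z hz hzY hzN
      rw [← hzY] at hz
      exact hz (subset_toMeasurable _ _ hzN)
    · exact ((hYm.measurable_mk.comp measurable_fst).add measurable_snd) hNm.compl
  have hseq : ∀ m : ℕ, ∃ ε : Fin l → ℝ, (∀ i, 0 < ε i ∧ ε i < 1 / ((m : ℝ) + 1)) ∧
      ν {z | Y z + ε ∈ N} = 0 := by
    intro m
    have hbox : volume (Set.univ.pi fun _ : Fin l => Set.Ioo (0 : ℝ) (1 / ((m : ℝ) + 1))) ≠ 0 := by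
      rw [Real.volume_pi_Ioo, Finset.prod_ne_zero_iff]
      intro i _
      rw [sub_zero]
      exact (ENNReal.ofReal_pos.2 Nat.one_div_pos_of_nat).ne'
    obtain ⟨ε, hε, hε'⟩ := ((frequently_ae_mem_iff.2 hbox).and_eventually hfub).exists
    exact ⟨ε, fun i => hε i (Set.mem_univ i), hε'⟩
  choose ε hε hε0 using hseq
  have hnull : ∀ (κ : Fin l → Fin l → ℕ) (m : ℕ),
      ν {z | z - slack κ (ε m) ∈ {z' | (fun i k => z' (i, k)) ∈ Admissible l ∧
        Y z' + ε m ∈ N}} = 0 := by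
    intro κ m
    refine measure_preimage_sub_eq_zero (fun p => ?_) ?_
      (measure_mono_null (fun z hz => hz.2) (hε0 m)) fun z hz p => ((hz.1 p.1).1 p.2).le
    · refine Finset.sum_nonneg fun i _ => ?_
      split_ifs
      exacts [(hε m i).1.le, le_rfl]
    · refine (Set.finite_iUnion fun i : Fin l =>
        Set.finite_range fun j : Fin l => (j, κ i j)).subset fun p hp => ?_
      obtain ⟨i, -, hi⟩ := Finset.exists_ne_zero_of_sum_ne_zero hp
      have hp2 : p.2 = κ i p.1 := by
        by_contra h
        exact hi (if_neg fun h' => h h'.2)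
      exact Set.mem_iUnion.2 ⟨i, p.1, Prod.ext rfl hp2.symm⟩
  have hall := ae_all_iff.2 fun κ : Fin l → Fin l → ℕ => ae_all_iff.2 fun m =>
    measure_eq_zero_iff_ae_notMem.1 (hnull κ m)
  rw [measure_eq_zero_iff_ae_notMem]
  filter_upwards [hall, ae_admissible hr hsum, ae_residual_pos hr hsum v₀] with z hz hza hzr
  rintro ⟨hv, hzN⟩
  choose n hn using hv
  have hw : ∀ i, 0 < wait (fun i k => z (i, k)) (state (fun i k => z (i, k)) v₀ (n i)) :=
    fun i => lt_min (hzr _ _) (hzr _ _)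
  obtain ⟨m, hm⟩ : ∃ m : ℕ, ∀ i,
      1 / ((m : ℝ) + 1) < wait (fun i k => z (i, k)) (state (fun i k => z (i, k)) v₀ (n i)) :=
    (Filter.eventually_all.2 fun i =>
      tendsto_one_div_add_atTop_nhds_zero_nat.eventually_lt_const (hw i)).exists
  obtain ⟨h₁, h₂⟩ := vertexTime_sub_slack hza hn fun i => ((hε m i).2.trans (hm i))
  refine hz _ m ⟨h₁, ?_⟩
  simp only [hY, Pi.sub_apply, h₂, sub_add_cancel]
  exact hzN

end AbsolutelyContinuous

end TimeLine

/-! ### The random walk -/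

namespace TimeLine

/-- Transfer of `measure_vertexTime_mem_eq_zero` to gaps defined on any probability space. -/
theorem ae_admissible_and_measure_eq_zero {l : ℕ} [NeZero l] {r : Fin l × ℕ → ℝ}
    (hr : ∀ p, 0 < r p) (hsum : ∀ i, Summable fun k => 1 / r (i, k))
    {Ω : Type*} [MeasurableSpace Ω] {P : Measure Ω} {E : Fin l → ℕ → Ω → ℝ}
    (hE : ∀ i k, HasLaw (E i k) (expMeasure (r (i, k))) P)
    (hind : iIndepFun (fun p : Fin l × ℕ => E p.1 p.2) P) (v₀ : Fin l) :
    (∀ᵐ ω ∂P, (fun i k => E i k ω) ∈ Admissible l) ∧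
    ∀ N : Set (Fin l → ℝ), volume N = 0 →
      P {ω | VisitsAll (fun i k => E i k ω) v₀ ∧ vertexTime (fun i k => E i k ω) v₀ ∈ N} = 0 := by
  have hprob : ∀ p, IsProbabilityMeasure (expMeasure (r p)) := fun p =>
    isProbabilityMeasure_expMeasure (hr p)
  have hm : AEMeasurable (fun ω (p : Fin l × ℕ) => E p.1 p.2 ω) P :=
    aemeasurable_pi_lambda _ fun p => (hE p.1 p.2).aemeasurable
  have hlaw : HasLaw (fun ω (p : Fin l × ℕ) => E p.1 p.2 ω)
      (Measure.infinitePi fun p => expMeasure (r p)) P :=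
    hind.hasLaw_infinitePi (fun p => hE p.1 p.2) hm
  refine ⟨?_, fun N hN => ?_⟩
  · have h := ae_admissible hr hsum
    rw [← hlaw.map_eq] at h
    exact ae_of_ae_map hm h
  · have h := measure_vertexTime_mem_eq_zero hr hsum v₀ hN
    rw [← hlaw.map_eq] at h
    exact Measure.preimage_null_of_map_null hm h

end TimeLine

theorem mainTheorem3 (l : ℕ) [NeZero l] (hl : 3 ≤ l) :
    -- the circulant matrix
    (TimeLine.cycleMatrix l).det = 1 - (-1 : ℝ) ^ l ∧
    (IsUnit (TimeLine.cycleMatrix l) ↔ Odd l) ∧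
    -- the deterministic walk: occupation times are finite, and `z = M y`
    (∀ x ∈ TimeLine.Admissible l, ∀ v₀ : Fin l,
      (∀ i, Summable (TimeLine.sojourn x v₀ i)) ∧
      TimeLine.edgeTime x v₀ = TimeLine.cycleMatrix l *ᵥ TimeLine.vertexTime x v₀) ∧
    -- the random walk driven by independent exponential variables
    ∀ (W : ℕ → ℝ) (_ : ∀ k, 0 < W k) (_ : Summable fun k => 1 / W k) (X₀ : Fin l → ℕ)
      (Ω : Type*) [MeasurableSpace Ω] (P : Measure Ω) [IsProbabilityMeasure P]
      (E : Fin l → ℕ → Ω → ℝ)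
      (_ : ∀ i k, HasLaw (E i k) (expMeasure (W (X₀ i + k))) P)
      (_ : iIndepFun (fun p : Fin l × ℕ => E p.1 p.2) P)
      (v₀ : Fin l),
      (∀ᵐ ω ∂P, (fun i k => E i k ω) ∈ TimeLine.Admissible l) ∧
      -- no nontrivial linear relation among the vertex occupation times
      (∀ (β : Fin l → ℝ) (c : ℝ), β ≠ 0 →
        P {ω | TimeLine.VisitsAll (fun i k => E i k ω) v₀ ∧
          β ⬝ᵥ TimeLine.vertexTime (fun i k => E i k ω) v₀ = c} = 0) ∧
      -- for odd `l`, no nontrivial linear relation among the edge times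
      (Odd l → ∀ (β : Fin l → ℝ) (c : ℝ), β ≠ 0 →
        P {ω | TimeLine.VisitsAll (fun i k => E i k ω) v₀ ∧
          β ⬝ᵥ TimeLine.edgeTime (fun i k => E i k ω) v₀ = c} = 0) ∧
      -- differentiable hypersurfaces
      (∀ M : Set (Fin l → ℝ), TimeLine.IsDifferentiableHypersurface M →
        P {ω | TimeLine.VisitsAll (fun i k => E i k ω) v₀ ∧
          TimeLine.vertexTime (fun i k => E i k ω) v₀ ∈ M} = 0) ∧
      -- level sets with nonvanishing gradient
      (∀ (A : Set (Fin l → ℝ)) (F : (Fin l → ℝ) → ℝ), IsOpen A → DifferentiableOn ℝ F A →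
        (∀ u ∈ A, F u = 0 → fderiv ℝ F u ≠ 0) →
        P {ω | TimeLine.VisitsAll (fun i k => E i k ω) v₀ ∧
          TimeLine.vertexTime (fun i k => E i k ω) v₀ ∈ A ∧
          F (TimeLine.vertexTime (fun i k => E i k ω) v₀) = 0} = 0) := by
  have hl2 : 2 ≤ l := by omega
  refine ⟨TimeLine.det_cycleMatrix hl2, TimeLine.isUnit_cycleMatrix_iff hl2,
    fun x hx v₀ => ⟨TimeLine.summable_sojourn hx v₀,
      funext fun i => (TimeLine.cycleMatrix_mulVec hl2 _ i).symm⟩, ?_⟩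
  intro W hW hWsum X₀ Ω _ P _ E hE hind v₀
  obtain ⟨hadm, hnull⟩ := TimeLine.ae_admissible_and_measure_eq_zero
    (r := fun p : Fin l × ℕ => W (X₀ p.1 + p.2)) (fun p => hW _)
    (fun i => by
      simpa only [add_comm (X₀ i)] using
        (summable_nat_add_iff (f := fun k => 1 / W k) (X₀ i)).2 hWsum)
    hE hind v₀
  have hlin : ∀ (β : Fin l → ℝ) (c : ℝ), β ≠ 0 →
      P {ω | TimeLine.VisitsAll (fun i k => E i k ω) v₀ ∧
        β ⬝ᵥ TimeLine.vertexTime (fun i k => E i k ω) v₀ = c} = 0 :=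
    fun β c hβ => hnull _ (TimeLine.volume_hyperplane_eq_zero hβ c)
  refine ⟨hadm, hlin, fun hodd β c hβ => ?_, fun M hM => ?_, fun A F hA hF hgrad => ?_⟩
  · have hz : ∀ x : Fin l → ℕ → ℝ, β ⬝ᵥ TimeLine.edgeTime x v₀ =
        (β ᵥ* TimeLine.cycleMatrix l) ⬝ᵥ TimeLine.vertexTime x v₀ := fun x => by
      rw [← Matrix.dotProduct_mulVec]
      congr 1
      exact funext fun i => (TimeLine.cycleMatrix_mulVec hl2 _ i).symm
    simp only [hz]
    refine hlin _ c fun h => hβ ?_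
    have hinj := Matrix.vecMul_injective_of_isUnit ((TimeLine.isUnit_cycleMatrix_iff hl2).2 hodd)
    exact hinj (h.trans (Matrix.zero_vecMul _).symm)
  · exact hnull _ (TimeLine.volume_hypersurface_eq_zero hM)
  · exact hnull _ (TimeLine.volume_zero_set_eq_zero hA hF hgrad)
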